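/- Let $d\ge 1$ and $H_d=\mathbb C^d$, and let $\mathbb{CP}^{d-1}$ be the space of unit vectors of $H_d$ up to phase, with its Borel $\sigma$-algebra. An \emph{ontological theory} in dimension $d$ with ontic space $\Lambda$ (a measurable space) consists of a probability measure $\mu_\psi$ on $\Lambda$ for each unit vector $\psi\in H_d$ and, for each orthonormal basis $M=\{\phi_1,\dots,\phi_d\}$ of $H_d$, measurable response functions $\xi_{k,M}:\Lambda\to[0,1]$, $1\le k\le d$, such that $$\int_\Lambda \xi_{k,M}\,d\mu_\psi=|\langle\phi_k|\psi\rangle|^2\quad\text{for all }\psi,k,M,\qquad \sum_{k=1}^d\xi_{k,M}(\lambda)=1\quad\text{for all }\lambda\in\Lambda\text{ and all }M.$$ Two states $\psi,\phi$ have \emph{nontrivial overlap} if the total variation distance $\frac12\int_\Lambda|d\mu_\psi-d\mu_\phi|$ is less than $1$. The theory is \emph{$\psi$-epistemic} if some two distinct states (unit vectors that differ by more than a phase) have nontrivial overlap, and it is \emph{maximally nontrivial} if $\psi$ and $\phi$ have nontrivial overlap whenever $\langle\psi|\phi\rangle\ne0$. A theory with $\Lambda=\mathbb{CP}^{d-1}$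 is \emph{strongly symmetric} if, for every unitary $U$ on $H_d$ and every unit vector $\psi$, the measure $\mu_{U\psi}$ is the image of $\mu_\psi$ under the action of $U$ on $\mathbb{CP}^{d-1}$; this is so, for instance, if $\mu_\psi$ has density $f(|\langle\psi|\lambda\rangle|^2)$ with respect to the uniform measure for one fixed nonnegative function $f$. \textbf{Theorem.} In dimension $d\ge3$ there exists no strongly symmetric, maximally nontrivial $\psi$-epistemic theory. -/

import Mathlib

open MeasureTheory

namespace PsiEpistemic

/-- The `d`-dimensional Hilbert space. -/
abbrev Hilb (d : ℕ) : Type := EuclideanSpace ℂ (Fin d)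

/-- Quantum states, given as unit vectors. (States that differ by a phase are *not* identified
here; the associated point of projective space is `ray ψ`.) -/
abbrev QState (d : ℕ) : Type := Metric.sphere (0 : Hilb d) 1

/-- Complex projective space `ℂℙ^(d-1)`. -/
abbrev CP (d : ℕ) : Type := Projectivization ℂ (Hilb d)

/-- `ℂℙ^(d-1)` carries the quotient topology. -/
noncomputable instance CP.instTopologicalSpace (d : ℕ) : TopologicalSpace (CP d) :=
  TopologicalSpace.coinduced (Projectivization.mk' ℂ (V := Hilb d)) inferInstance

/-- `ℂℙ^(d-1)` carries its Borel sigma-algebra. -/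
noncomputable instance CP.instMeasurableSpace (d : ℕ) : MeasurableSpace (CP d) := borel (CP d)

instance CP.instBorelSpace (d : ℕ) : BorelSpace (CP d) := ⟨rfl⟩

/-- The point of projective space represented by a unit vector. -/
noncomputable def ray {d : ℕ} (ψ : QState d) : CP d :=
  Projectivization.mk ℂ (ψ : Hilb d) (ne_zero_of_mem_unit_sphere ψ)

/-- The action of a unitary on quantum states. -/
noncomputable def unitaryState {d : ℕ} (U : Hilb d ≃ₗᵢ[ℂ] Hilb d) (ψ : QState d) : QState d :=
  ⟨U (ψ : Hilb d), by simp⟩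

/-- The action of a unitary on projective space. -/
noncomputable def unitaryCP {d : ℕ} (U : Hilb d ≃ₗᵢ[ℂ] Hilb d) : CP d → CP d :=
  Projectivization.map (U.toLinearEquiv : Hilb d →ₗ[ℂ] Hilb d) U.injective

/-- The action of a unitary on projective space is continuous. -/
theorem continuous_unitaryCP {d : ℕ} (U : Hilb d ≃ₗᵢ[ℂ] Hilb d) :
    Continuous (unitaryCP U) := by
  rw [continuous_coinduced_dom]
  have hmk : Continuous (Projectivization.mk' ℂ (V := Hilb d)) := continuous_coinduced_rng
  have hU : Continuous (fun v : {v : Hilb d // v ≠ 0} =>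
      (⟨U v, fun h => v.2 (by simpa using h)⟩ : {v : Hilb d // v ≠ 0})) :=
    Continuous.subtype_mk (U.continuous.comp continuous_subtype_val) _
  exact hmk.comp hU

/-- Hence it is measurable, so that pushing measures forward along it is meaningful. -/
theorem measurable_unitaryCP {d : ℕ} (U : Hilb d ≃ₗᵢ[ℂ] Hilb d) :
    Measurable (unitaryCP U) :=
  (continuous_unitaryCP U).measurable

/-- The total variation distance `(1/2) ∫ |dμ - dν|` of two probability measures: half of the
total mass of the total variation of the signed measure `μ - ν`. -/
noncomputable def tvDist {Λ : Type*} [MeasurableSpace Λ] (μ ν : ProbabilityMeasure Λ) : ℝ :=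
  (1 / 2) * (((μ : Measure Λ).toSignedMeasure - (ν : Measure Λ).toSignedMeasure).totalVariation
    Set.univ).toReal

/-- An ontological theory of `d`-dimensional quantum mechanics with ontic space `Λ`. The response
functions may depend on the whole (ordered) orthonormal measurement basis `M`. -/
structure OntologicalTheory (d : ℕ) (Λ : Type*) [MeasurableSpace Λ] where
  /-- the probability measure over ontic states associated with a quantum state -/
  μ : QState d → ProbabilityMeasure Λ
  /-- the response functions: `ξ M k lam` is the probability of outcome `M k` at `lam` -/
  ξ : OrthonormalBasis (Fin d) ℂ (Hilb d) → Fin d → Λ → ℝ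
  measurable_response : ∀ M k, Measurable (ξ M k)
  response_mem : ∀ M k lam, ξ M k lam ∈ Set.Icc (0 : ℝ) 1
  born_rule : ∀ M k ψ, ∫ lam, ξ M k lam ∂(μ ψ : Measure Λ) = ‖inner ℂ (M k) (ψ : Hilb d)‖ ^ 2
  sum_response : ∀ M lam, ∑ k, ξ M k lam = 1

namespace OntologicalTheory

variable {d : ℕ} {Λ : Type*} [MeasurableSpace Λ]

/-- Nontrivial overlap of two quantum states: total variation distance less than `1`. -/
def NontrivialOverlap (T : OntologicalTheory d Λ) (ψ φ : QState d) : Prop :=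
  tvDist (T.μ ψ) (T.μ φ) < 1

/-- A theory is `ψ`-epistemic if some two distinct quantum states (that is, unit vectors that
differ by more than a phase) have nontrivial overlap. -/
def IsPsiEpistemic (T : OntologicalTheory d Λ) : Prop :=
  ∃ ψ φ : QState d, ray ψ ≠ ray φ ∧ T.NontrivialOverlap ψ φ

/-- A theory is maximally nontrivial if all non-orthogonal states have nontrivial overlap. -/
def IsMaximallyNontrivial (T : OntologicalTheory d Λ) : Prop :=
  ∀ ψ φ : QState d, inner ℂ (ψ : Hilb d) (φ : Hilb d) ≠ 0 → T.NontrivialOverlap ψ φ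

/-- A theory with ontic space `ℂℙ^(d-1)` is strongly symmetric if `μ_{Uψ}(U lam) = μ_ψ(lam)` for
all unitaries `U`, that is, `μ_{Uψ}` is the image of `μ_ψ` under `U`. In particular this holds
whenever `μ_ψ` has density `f(|⟨ψ|lam⟩|²)` with respect to the uniform measure on `ℂℙ^(d-1)`, for
one function `f` that does not depend on `ψ`. -/
def IsStronglySymmetric (T : OntologicalTheory d (CP d)) : Prop :=
  ∀ (U : Hilb d ≃ₗᵢ[ℂ] Hilb d) (ψ : QState d),
    (T.μ (unitaryState U ψ) : Measure (CP d)) = (T.μ ψ : Measure (CP d)).map (unitaryCP U)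

end OntologicalTheory

end PsiEpistemic

namespace PsiEpistemic

/-! Call ‖v i‖²/‖v‖² the i-weight of `v`. Two states with inner product 11/61 must have overlapping
measures. By a Bessel-type inequality no ray can have weight above 3/5 on both, so, by symmetry, the
measure of e_j charges rays of j-weight at most 3/5 (`measure_weightLE_ne_zero`).

Let s fix e_j and g fix e_i, with i ≠ j. Then g s e_j is orthogonal to e_i, so by the Born rule its
measure, the image of that of e_j under g s, gives mass zero to the set N where outcome i has
nonzero response. Fubini yields a ray [l] of j-weight at most 3/5 with g s [l] ∉ N for almost all
(s, g). The vectors s l take all i-weights up to 1 minus the j-weight of l, and g then moves freely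
at fixed i-weight. So N is Lebesgue-null where the i-weight is below 2/5 (`null_cone_of_ae_ae`,
`null_coneOver_response`).

For d ≥ 3 the vectors with all weights below 2/5 form a nonempty open set. Almost everywhere on it
all responses to the standard basis vanish, although they sum to 1. -/

/-! ### Compactness of the unitary group and invariant measures on stabilizers -/

/-- The unitary group of `Hilb d`, as a topological group. -/
abbrev UGroup (d : ℕ) : Type := unitary (Hilb d →L[ℂ] Hilb d)

theorem continuousStar_end (d : ℕ) : ContinuousStar (Hilb d →L[ℂ] Hilb d) :=
  ⟨(ContinuousLinearMap.adjoint (𝕜 := ℂ) (E := Hilb d) (F := Hilb d)).continuous⟩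

instance UGroup.instIsTopologicalGroup (d : ℕ) : IsTopologicalGroup (UGroup d) where
  continuous_inv := by
    have := continuousStar_end d
    refine Continuous.subtype_mk (f := fun g : UGroup d => star (g : Hilb d →L[ℂ] Hilb d)) ?_ _
    exact continuous_star.comp continuous_subtype_val

instance UGroup.instCompactSpace (d : ℕ) : CompactSpace (UGroup d) := by
  have := continuousStar_end d
  have : ProperSpace (Hilb d →L[ℂ] Hilb d) := FiniteDimensional.proper ℂ _
  refine isCompact_iff_compactSpace.mp (Metric.isCompact_of_isClosed_isBounded
    isClosed_unitary ?_)
  refine (Metric.isBounded_closedBall (x := (0 : Hilb d →L[ℂ] Hilb d)) (r := 1)).subset ?_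
  intro g hg
  rw [mem_closedBall_zero_iff]
  refine ContinuousLinearMap.opNorm_le_bound _ zero_le_one fun v => ?_
  have := (Unitary.linearIsometryEquiv ⟨g, hg⟩).norm_map v
  rw [one_mul]
  exact this.le

/-- The subgroup of unitaries that fix a vector. -/
noncomputable def fixer {d : ℕ} (e : Hilb d) : Subgroup (UGroup d) where
  carrier := {g | (g : Hilb d →L[ℂ] Hilb d) e = e}
  mul_mem' {a b} ha hb := by
    rw [Set.mem_ofPred_eq] at *
    change (a : Hilb d →L[ℂ] Hilb d) ((b : Hilb d →L[ℂ] Hilb d) e) = e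
    rw [hb, ha]
  one_mem' := rfl
  inv_mem' {a} ha := by
    have h : ((a⁻¹ * a : UGroup d) : Hilb d →L[ℂ] Hilb d) e = e := by
      rw [inv_mul_cancel]; rfl
    change ((a⁻¹ : UGroup d) : Hilb d →L[ℂ] Hilb d) e = e
    conv_lhs => rw [← (show (a : Hilb d →L[ℂ] Hilb d) e = e from ha)]
    exact h

theorem mem_fixer {d : ℕ} {e : Hilb d} {g : UGroup d} :
    g ∈ fixer e ↔ (g : Hilb d →L[ℂ] Hilb d) e = e := Iff.rfl

theorem isClosed_fixer {d : ℕ} (e : Hilb d) : IsClosed (fixer e : Set (UGroup d)) :=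
  isClosed_eq (continuous_subtype_val.clm_apply continuous_const) continuous_const

/-- A closed subgroup of a compact group carries a finite nonzero right-invariant measure. -/
theorem exists_rightInvariant_measure {G : Type*} [Group G] [TopologicalSpace G]
    [IsTopologicalGroup G] [CompactSpace G] [MeasurableSpace G] [BorelSpace G]
    (K : Subgroup G) (hK : IsClosed (K : Set G)) :
    ∃ γ : Measure G, IsFiniteMeasure γ ∧ γ ≠ 0 ∧ (∀ᵐ g ∂γ, g ∈ K) ∧
      ∀ k ∈ K, γ.map (· * k) = γ := by
  have : CompactSpace K := isCompact_iff_compactSpace.mp hK.isCompact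
  -- Haar measure is left-invariant; inversion makes it right-invariant, which allows `v` to be
  -- replaced by `k v` inside events about `g v`.
  let ν : Measure K := (Measure.haar : Measure K).inv
  have hval : Measurable (Subtype.val : K → G) := measurable_subtype_coe
  have hmul : ∀ k : G, Measurable (· * k : G → G) := fun k =>
    (continuous_mul_const k).measurable
  have hfin : IsFiniteMeasure ν := by
    constructor
    simp only [ν, Measure.inv_apply, Set.inv_univ]
    exact measure_lt_top _ _
  refine ⟨ν.map Subtype.val, inferInstance, ?_, ?_, ?_⟩
  · rw [Ne, Measure.map_eq_zero_iff hval.aemeasurable, ← Measure.measure_univ_eq_zero]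
    simp only [ν, Measure.inv_apply, Set.inv_univ]
    exact (isOpen_univ.measure_pos _ Set.univ_nonempty).ne'
  · refine (ae_map_iff hval.aemeasurable hK.measurableSet).mpr ?_
    exact Filter.Eventually.of_forall fun x => x.2
  · intro k hk
    rw [Measure.map_map (hmul k) hval]
    conv_rhs => rw [← map_mul_right_eq_self ν ⟨k, hk⟩]
    have hmul' : Measurable (· * (⟨k, hk⟩ : K) : K → K) := (continuous_mul_const _).measurable
    rw [Measure.map_map hval hmul']
    rfl

/-! ### Transitivity of the stabilizer of a basis vector -/

/-- Two orthonormal pairs with the same first vector are related by a unitary. -/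
theorem exists_unitary_map_pair {d : ℕ} {e v w : Hilb d} (he : ‖e‖ = 1) (hv : ‖v‖ = 1)
    (hw : ‖w‖ = 1) (hev : inner ℂ e v = 0) (hew : inner ℂ e w = 0) :
    ∃ U : Hilb d ≃ₗᵢ[ℂ] Hilb d, U e = e ∧ U v = w := by
  have key : ∀ x : Hilb d, ‖x‖ = 1 → inner ℂ e x = 0 →
      Orthonormal ℂ ![e, x] := by
    intro x hx hex
    rw [orthonormal_vecCons_iff]
    simp [he, hex, hx]
  have hcard : 2 ≤ d := by
    simpa using (key v hv hev).linearIndependent.fintype_card_le_finrank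
  obtain ⟨m, rfl⟩ := Nat.exists_eq_add_of_le hcard
  have ext : ∀ x : Hilb (2 + m), ‖x‖ = 1 → inner ℂ e x = 0 →
      ∃ b : OrthonormalBasis (Fin (2 + m)) ℂ (Hilb (2 + m)),
        b (Fin.castAdd m 0) = e ∧ b (Fin.castAdd m 1) = x := by
    intro x hx hex
    have h := key x hx hex
    let f : Fin (2 + m) → Hilb (2 + m) := Fin.append ![e, x] 0
    obtain ⟨b, hb⟩ := Orthonormal.exists_orthonormalBasis_extension_of_card_eq (𝕜 := ℂ)
      (E := Hilb (2 + m)) (ι := Fin (2 + m)) (by simp) (v := f)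
      (s := Set.range (Fin.castAdd m)) (by
        let σ : Set.range (Fin.castAdd m : Fin 2 → Fin (2 + m)) ≃ Fin 2 :=
          (Equiv.ofInjective _ (Fin.castAdd_injective 2 m)).symm
        have : (Set.range (Fin.castAdd m)).domRestrict f = ![e, x] ∘ σ := by
          funext ⟨_, k, rfl⟩
          have : σ ⟨Fin.castAdd m k, k, rfl⟩ = k :=
            (Equiv.ofInjective _ (Fin.castAdd_injective 2 m)).symm_apply_apply k
          simp only [Function.comp, this]
          exact Fin.append_left _ _ k
        rw [this]
        exact h.comp _ σ.injective)
    refine ⟨b, ?_, ?_⟩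
    · rw [hb _ ⟨0, rfl⟩]; exact Fin.append_left _ _ 0
    · rw [hb _ ⟨1, rfl⟩]; exact Fin.append_left _ _ 1
  obtain ⟨b, hb0, hb1⟩ := ext v hv hev
  obtain ⟨b', hb0', hb1'⟩ := ext w hw hew
  refine ⟨b.equiv b' (Equiv.refl _), ?_, ?_⟩
  · conv_lhs => rw [← hb0]
    simp [hb0']
  · conv_lhs => rw [← hb1]
    simp [hb1']

/-- The standard basis vectors. -/
noncomputable abbrev stdVec {d : ℕ} (i : Fin d) : Hilb d := EuclideanSpace.single i (1 : ℂ)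

theorem inner_stdVec {d : ℕ} (i : Fin d) (v : Hilb d) : inner ℂ (stdVec i) v = v i := by
  simp [stdVec, EuclideanSpace.inner_single_left]

theorem add_smul_stdVec_self {d : ℕ} (i : Fin d) (v : Hilb d) (a : ℂ) :
    (v + a • stdVec i) i = v i + a := by
  simp [stdVec]

theorem add_smul_stdVec_of_ne {d : ℕ} {i k : Fin d} (h : k ≠ i) (v : Hilb d) (a : ℂ) :
    (v + a • stdVec i) k = v k := by
  simp [stdVec, h]

theorem norm_sq_add_smul_stdVec {d : ℕ} (i : Fin d) (v : Hilb d) (a : ℂ) :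
    ‖v + a • stdVec i‖ ^ 2 = ‖v‖ ^ 2 - ‖v i‖ ^ 2 + ‖v i + a‖ ^ 2 := by
  rw [EuclideanSpace.norm_sq_eq, EuclideanSpace.norm_sq_eq,
    ← Finset.add_sum_erase (f := fun k => ‖(v + a • stdVec i) k‖ ^ 2) _ (Finset.mem_univ i),
    ← Finset.add_sum_erase (f := fun k => ‖v k‖ ^ 2) _ (Finset.mem_univ i),
    add_smul_stdVec_self]
  have : ∑ k ∈ Finset.univ.erase i, ‖(v + a • stdVec i) k‖ ^ 2
      = ∑ k ∈ Finset.univ.erase i, ‖v k‖ ^ 2 :=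
    Finset.sum_congr rfl fun k hk => by rw [add_smul_stdVec_of_ne (Finset.ne_of_mem_erase hk)]
  rw [this]
  ring

theorem sum_three_norm_sq_le {d : ℕ} {i j k : Fin d} (hij : i ≠ j) (hik : i ≠ k) (hjk : j ≠ k)
    (v : Hilb d) : ‖v i‖ ^ 2 + ‖v j‖ ^ 2 + ‖v k‖ ^ 2 ≤ ‖v‖ ^ 2 := by
  rw [EuclideanSpace.norm_sq_eq]
  calc ‖v i‖ ^ 2 + ‖v j‖ ^ 2 + ‖v k‖ ^ 2 = ∑ m ∈ {i, j, k}, ‖v m‖ ^ 2 := by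
        rw [Finset.sum_insert (by simp [hij, hik]), Finset.sum_pair hjk, add_assoc]
    _ ≤ _ := Finset.sum_le_univ_sum_of_nonneg fun m => sq_nonneg _

theorem UGroup.norm_apply {d : ℕ} (g : UGroup d) (v : Hilb d) :
    ‖(g : Hilb d →L[ℂ] Hilb d) v‖ = ‖v‖ :=
  (Unitary.linearIsometryEquiv g).norm_map v

theorem UGroup.apply_ne_zero {d : ℕ} (g : UGroup d) {v : Hilb d} (hv : v ≠ 0) :
    (g : Hilb d →L[ℂ] Hilb d) v ≠ 0 := by
  rwa [← norm_ne_zero_iff, g.norm_apply, norm_ne_zero_iff]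

/-- Unitarity gives ⟨e_i, g v⟩ = ⟨g e_i, g v⟩ = ⟨e_i, v⟩. -/
theorem fixer_apply_coord {d : ℕ} {i : Fin d} {g : UGroup d} (hg : g ∈ fixer (stdVec i))
    (v : Hilb d) : (g : Hilb d →L[ℂ] Hilb d) v i = v i := by
  rw [← inner_stdVec, ← inner_stdVec]
  conv_lhs => rw [← mem_fixer.mp hg]
  exact (Unitary.linearIsometryEquiv g).inner_map_map _ _

/-- The stabilizer of a basis vector acts transitively on vectors with the same relative weight on
this basis vector, up to scalars. -/
theorem exists_fixer_apply_eq_smul {d : ℕ} {i : Fin d} {v w : Hilb d} (hv : v ≠ 0) (hw : w ≠ 0)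
    (h : ‖v i‖ ^ 2 * ‖w‖ ^ 2 = ‖w i‖ ^ 2 * ‖v‖ ^ 2) :
    ∃ g ∈ fixer (stdVec i), ∃ c : ℂ, c ≠ 0 ∧ (g : Hilb d →L[ℂ] Hilb d) v = c • w := by
  have hv' := norm_pos_iff.mpr hv
  have hw' := norm_pos_iff.mpr hw
  have h1 : ‖v i‖ * ‖w‖ = ‖w i‖ * ‖v‖ := by
    have : (‖v i‖ * ‖w‖) ^ 2 = (‖w i‖ * ‖v‖) ^ 2 := by rw [mul_pow, mul_pow, h]
    exact (pow_left_inj₀ (by positivity) (by positivity) two_ne_zero).mp this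
  -- Scaling `w` by `c` matches both the i-th coordinate and the norm with those of `v`; the
  -- components orthogonal to e_i then have equal norms, and a unitary fixing e_i carries one to the
  -- other.
  obtain ⟨c, hc, hci, hcn⟩ : ∃ c : ℂ, c ≠ 0 ∧ v i = (c • w) i ∧ ‖v‖ = ‖c • w‖ := by
    by_cases hvi : v i = 0
    · have hwi : w i = 0 := by
        rw [hvi, norm_zero, zero_mul] at h1
        simpa [hv'.ne'] using h1.symm
      refine ⟨((‖v‖ / ‖w‖ : ℝ) : ℂ), ?_, by simp [hvi, hwi], ?_⟩
      · exact_mod_cast (div_pos hv' hw').ne'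
      · rw [norm_smul, Complex.norm_real, Real.norm_eq_abs, abs_of_pos (div_pos hv' hw')]
        field_simp
    · have hwi : w i ≠ 0 := by
        intro h0
        rw [h0, norm_zero, zero_mul, mul_eq_zero, norm_eq_zero] at h1
        exact h1.elim hvi hw'.ne'
      refine ⟨v i / w i, div_ne_zero hvi hwi, by simp [hwi], ?_⟩
      rw [norm_smul, norm_div]
      have := norm_ne_zero_iff.mpr hwi
      field_simp
      linarith
  set e : Hilb d := stdVec i
  have he : ‖e‖ = 1 := by simp [e, stdVec]
  have horth : ∀ x : Hilb d, inner ℂ e (x + (-x i) • e) = 0 := fun x => by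
    rw [inner_stdVec, add_smul_stdVec_self, add_neg_cancel]
  have hnorm : ∀ x : Hilb d, ‖x + (-x i) • e‖ ^ 2 = ‖x‖ ^ 2 - ‖x i‖ ^ 2 := fun x => by
    rw [norm_sq_add_smul_stdVec, add_neg_cancel]; simp
  set p : Hilb d := v + (-v i) • e with hp
  set q : Hilb d := (c • w) + (-(c • w) i) • e with hq
  have hpq : ‖p‖ = ‖q‖ := by
    have : ‖p‖ ^ 2 = ‖q‖ ^ 2 := by rw [hnorm, hnorm, hci, hcn]
    exact (pow_left_inj₀ (by positivity) (by positivity) two_ne_zero).mp this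
  have hve : v = p + v i • e := by rw [hp, neg_smul]; abel
  have hwe : c • w = q + v i • e := by rw [hq, neg_smul, ← hci]; abel
  by_cases hp0 : p = 0
  · have hq0 : q = 0 := by rwa [hp0, norm_zero, eq_comm, norm_eq_zero] at hpq
    refine ⟨1, one_mem _, c, hc, ?_⟩
    change v = c • w
    rw [hve, hwe, hp0, hq0]
  · have hpn := norm_ne_zero_iff.mpr hp0
    obtain ⟨U, hUe, hU⟩ := exists_unitary_map_pair (e := e) (v := ((‖p‖⁻¹ : ℝ) : ℂ) • p)
      (w := ((‖p‖⁻¹ : ℝ) : ℂ) • q) he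
      (by rw [norm_smul, Complex.norm_real, norm_inv, norm_norm, inv_mul_cancel₀ hpn])
      (by rw [norm_smul, Complex.norm_real, norm_inv, norm_norm, ← hpq, inv_mul_cancel₀ hpn])
      (by rw [inner_smul_right, horth, mul_zero]) (by rw [inner_smul_right, horth, mul_zero])
    have hUp : U p = q := by
      rw [map_smul] at hU
      exact smul_right_injective _ (by exact_mod_cast inv_ne_zero hpn) hU
    refine ⟨Unitary.linearIsometryEquiv.symm U, ?_, c, hc, ?_⟩
    · exact hUe
    · change U v = c • w
      rw [hve, hwe, map_add, map_smul, hUp, hUe]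

/-! ### Null sets under averaging over unitaries -/

theorem measurable_UGroup_apply {d : ℕ} :
    Measurable fun z : Hilb d × UGroup d => (z.2 : Hilb d →L[ℂ] Hilb d) z.1 :=
  (Continuous.clm_apply (continuous_subtype_val.comp continuous_snd) continuous_fst).measurable

/-- Averaging over unitaries preserves and reflects Lebesgue-null sets. -/
theorem null_of_ae_ae_notMem {d : ℕ} {m : Measure (Hilb d)} [m.IsAddHaarMeasure]
    {γ : Measure (UGroup d)} [SFinite γ] (hγ : γ ≠ 0) {D : Set (Hilb d)}
    (hD : MeasurableSet D)
    (h : ∀ᵐ v ∂m, ∀ᵐ (g : UGroup d) ∂γ, (g : Hilb d →L[ℂ] Hilb d) v ∉ D) : m D = 0 := by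
  have h := (Measure.ae_ae_comm
    (p := fun v (g : UGroup d) => (g : Hilb d →L[ℂ] Hilb d) v ∉ D)
    (measurable_UGroup_apply hD.compl)).mp h
  have : (ae γ).NeBot := ae_neBot.mpr hγ
  -- One good `g` suffices: it is a linear surjection, so `D` is the image of its null preimage.
  obtain ⟨g, hg⟩ := h.exists
  have hnull : m ((g : Hilb d →L[ℂ] Hilb d) ⁻¹' D) = 0 := by
    exact measure_mono_null (fun a ha => not_not.mpr ha) (ae_iff.mp hg)
  have himg := addHaar_image_eq_zero_of_differentiableOn_of_addHaar_eq_zero m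
    (f := (g : Hilb d →L[ℂ] Hilb d)) (s := (g : Hilb d →L[ℂ] Hilb d) ⁻¹' D)
    (((g : Hilb d →L[ℂ] Hilb d).restrictScalars ℝ).differentiable.differentiableOn) hnull
  have hsurj : Function.Surjective (g : Hilb d →L[ℂ] Hilb d) :=
    (Unitary.linearIsometryEquiv g).surjective
  rwa [Set.image_preimage_eq _ hsurj] at himg

/-- The vectors in `{v | ‖v i‖² < b ‖v‖²}` whose orbit under `γ` meets `A` with positive
probability. -/
def hitSet {d : ℕ} (γ : Measure (UGroup d)) (A : Set (Hilb d)) (i : Fin d) (b : ℝ) :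
    Set (Hilb d) :=
  {v | v ≠ 0 ∧ ‖v i‖ ^ 2 < b * ‖v‖ ^ 2 ∧
    γ {g : UGroup d | (g : Hilb d →L[ℂ] Hilb d) v ∈ A} ≠ 0}

theorem measurableSet_hitSet {d : ℕ} {γ : Measure (UGroup d)} [SFinite γ] {A : Set (Hilb d)}
    (hA : MeasurableSet A) (i : Fin d) (b : ℝ) : MeasurableSet (hitSet γ A i b) := by
  have h1 : MeasurableSet {v : Hilb d | v ≠ 0} := (measurableSet_singleton 0).compl
  have h2 : MeasurableSet {v : Hilb d | ‖v i‖ ^ 2 < b * ‖v‖ ^ 2} :=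
    (isOpen_lt (f := fun v : Hilb d => ‖v i‖ ^ 2) (by fun_prop) (by fun_prop)).measurableSet
  have h3 : Measurable fun v : Hilb d =>
      γ (Prod.mk v ⁻¹' {z : Hilb d × UGroup d | (z.2 : Hilb d →L[ℂ] Hilb d) z.1 ∈ A}) :=
    measurable_measure_prodMk_left (measurable_UGroup_apply hA)
  exact h1.inter (h2.inter (h3 (measurableSet_singleton 0).compl))

theorem ae_mul_right {d : ℕ} {γ : Measure (UGroup d)} {k : UGroup d}
    (hk : γ.map (· * k) = γ) {p : UGroup d → Prop} (h : ∀ᵐ g ∂γ, p g) : ∀ᵐ g ∂γ, p (g * k) := by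
  rw [← hk] at h
  exact ae_of_ae_map (measurable_mul_const k).aemeasurable h

/-- Whether a random element of the stabilizer of a basis vector moves `v` into a cone `A` depends
only on the relative weight of `v` on this basis vector. -/
theorem ae_apply_notMem_of_ratio_eq {d : ℕ} {γ : Measure (UGroup d)} {i : Fin d}
    (hinv : ∀ k ∈ fixer (stdVec i), γ.map (· * k) = γ) {A : Set (Hilb d)}
    (hcone : ∀ (c : ℂ) (v : Hilb d), c ≠ 0 → c • v ∈ A → v ∈ A) {v w : Hilb d} (hv : v ≠ 0)
    (hw : w ≠ 0) (h : ‖v i‖ ^ 2 * ‖w‖ ^ 2 = ‖w i‖ ^ 2 * ‖v‖ ^ 2)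
    (hvA : ∀ᵐ (g : UGroup d) ∂γ, (g : Hilb d →L[ℂ] Hilb d) v ∉ A) :
    ∀ᵐ (g : UGroup d) ∂γ, (g : Hilb d →L[ℂ] Hilb d) w ∉ A := by
  obtain ⟨k, hk, c, hc, hkc⟩ := exists_fixer_apply_eq_smul hv hw h
  filter_upwards [ae_mul_right (hinv k hk) hvA] with g hg hgA
  refine hg (hcone c⁻¹ _ (inv_ne_zero hc) ?_)
  change c⁻¹ • (g : Hilb d →L[ℂ] Hilb d) ((k : Hilb d →L[ℂ] Hilb d) v) ∈ A
  rwa [hkc, map_smul, inv_smul_smul₀ hc]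

theorem mem_hitSet_of_ratio_eq {d : ℕ} {γ : Measure (UGroup d)} {i : Fin d}
    (hinv : ∀ k ∈ fixer (stdVec i), γ.map (· * k) = γ) {A : Set (Hilb d)}
    (hcone : ∀ (c : ℂ) (v : Hilb d), c ≠ 0 → c • v ∈ A → v ∈ A) {b : ℝ} {v w : Hilb d}
    (hw : w ≠ 0) (h : ‖v i‖ ^ 2 * ‖w‖ ^ 2 = ‖w i‖ ^ 2 * ‖v‖ ^ 2) (hvA : v ∈ hitSet γ A i b) :
    w ∈ hitSet γ A i b := by
  obtain ⟨hv, hvb, hγ⟩ := hvA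
  refine ⟨hw, ?_, fun h0 => hγ ?_⟩
  · have hv' : 0 < ‖v‖ ^ 2 := by positivity
    have hw' : 0 < ‖w‖ ^ 2 := by positivity
    have : ‖w i‖ ^ 2 * ‖v‖ ^ 2 < b * ‖w‖ ^ 2 * ‖v‖ ^ 2 := by
      rw [← h]; nlinarith
    exact lt_of_mul_lt_mul_right this hv'.le
  · have := ae_apply_notMem_of_ratio_eq hinv hcone hw hv h.symm
      (measure_eq_zero_iff_ae_notMem.mp h0)
    exact measure_eq_zero_iff_ae_notMem.mpr this

/-! ### Maps that adjust the weights -/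

/-- Replaces the `j`-th coordinate so that its relative weight becomes `t`. -/
noncomputable def setWeight {d : ℕ} (j : Fin d) (t : ℝ) (v : Hilb d) : Hilb d :=
  v + ((Real.sqrt (t / (1 - t) * (‖v‖ ^ 2 - ‖v j‖ ^ 2)) : ℝ) - v j : ℂ) • stdVec j

theorem continuous_setWeight {d : ℕ} (j : Fin d) (t : ℝ) :
    Continuous (setWeight j t : Hilb d → Hilb d) := by
  unfold setWeight; fun_prop

theorem setWeight_of_ne {d : ℕ} {j k : Fin d} (h : k ≠ j) (t : ℝ) (v : Hilb d) :
    setWeight j t v k = v k := add_smul_stdVec_of_ne h _ _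

theorem norm_coord_sq_le {d : ℕ} (j : Fin d) (v : Hilb d) : ‖v j‖ ^ 2 ≤ ‖v‖ ^ 2 :=
  pow_le_pow_left₀ (norm_nonneg _) (PiLp.norm_apply_le v j) 2

theorem norm_sq_setWeight_self {d : ℕ} (j : Fin d) {t : ℝ} (ht0 : 0 ≤ t) (ht1 : t < 1)
    (v : Hilb d) : ‖setWeight j t v j‖ ^ 2 = t / (1 - t) * (‖v‖ ^ 2 - ‖v j‖ ^ 2) := by
  have := norm_coord_sq_le j v
  have h0 : 0 ≤ t / (1 - t) * (‖v‖ ^ 2 - ‖v j‖ ^ 2) :=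
    mul_nonneg (div_nonneg ht0 (by linarith)) (by linarith)
  rw [setWeight, add_smul_stdVec_self, add_sub_cancel, Complex.norm_real, Real.norm_eq_abs, sq_abs,
    Real.sq_sqrt h0]

theorem norm_sq_setWeight {d : ℕ} (j : Fin d) {t : ℝ} (ht0 : 0 ≤ t) (ht1 : t < 1)
    (v : Hilb d) : ‖setWeight j t v‖ ^ 2 = (‖v‖ ^ 2 - ‖v j‖ ^ 2) / (1 - t) := by
  have h := norm_sq_setWeight_self j ht0 ht1 v
  rw [setWeight, add_smul_stdVec_self] at h
  rw [setWeight, norm_sq_add_smul_stdVec, h]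
  have : 1 - t ≠ 0 := by linarith
  field_simp
  ring

/-- The new j-th coordinate depends only on ‖v‖ and `v j`, both of which `g` preserves. -/
theorem apply_setWeight {d : ℕ} {j : Fin d} {g : UGroup d} (hg : g ∈ fixer (stdVec j)) (t : ℝ)
    (v : Hilb d) : (g : Hilb d →L[ℂ] Hilb d) (setWeight j t v)
      = setWeight j t ((g : Hilb d →L[ℂ] Hilb d) v) := by
  rw [setWeight, setWeight, map_add, map_smul, mem_fixer.mp hg, fixer_apply_coord hg, g.norm_apply]

/-- Rescales the `i`-th coordinate so that its relative weight becomes what it is in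
`setWeight j t v`. -/
noncomputable def rescale {d : ℕ} (i j : Fin d) (t : ℝ) (v : Hilb d) : Hilb d :=
  -- The factor ρ on the i-th coordinate solves ρ²‖v i‖²/(ρ²‖v i‖² + ‖v‖² - ‖v i‖²) = (1-t)‖v
  -- i‖²/(‖v‖² - ‖v j‖²).
  v + ((Real.sqrt ((1 - t) * (‖v‖ ^ 2 - ‖v i‖ ^ 2) /
    (t * ‖v i‖ ^ 2 + (‖v‖ ^ 2 - ‖v i‖ ^ 2 - ‖v j‖ ^ 2))) - 1 : ℝ) * v i : ℂ) • stdVec i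

/-- A nonzero third coordinate keeps the denominator and the radicand positive. Differentiability
makes `rescale` send null sets to null sets. -/
theorem differentiableAt_rescale {d : ℕ} {i j k : Fin d} (hij : i ≠ j) (hik : i ≠ k) (hjk : j ≠ k)
    {t : ℝ} (ht0 : 0 ≤ t) (ht1 : t < 1) {v : Hilb d} (hv : v k ≠ 0) :
    DifferentiableAt ℝ (rescale i j t) v := by
  have h3 := sum_three_norm_sq_le hij hik hjk v
  have hk : 0 < ‖v k‖ ^ 2 := by positivity
  have hcoord : ∀ m : Fin d, DifferentiableAt ℝ (fun v : Hilb d => v m) v := fun m =>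
    (((EuclideanSpace.proj m : Hilb d →L[ℂ] ℂ)).restrictScalars ℝ).differentiableAt
  have hn : DifferentiableAt ℝ (fun v : Hilb d => ‖v‖ ^ 2) v := differentiableAt_id.norm_sq ℂ
  have hc : ∀ m : Fin d, DifferentiableAt ℝ (fun v : Hilb d => ‖v m‖ ^ 2) v := fun m =>
    (hcoord m).norm_sq ℂ
  have hden : 0 < t * ‖v i‖ ^ 2 + (‖v‖ ^ 2 - ‖v i‖ ^ 2 - ‖v j‖ ^ 2) := by
    have : 0 ≤ t * ‖v i‖ ^ 2 := by positivity
    linarith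
  have hnum : 0 < (1 - t) * (‖v‖ ^ 2 - ‖v i‖ ^ 2) :=
    mul_pos (by linarith) (by have := sq_nonneg ‖v j‖; linarith)
  have hd : DifferentiableAt ℝ (fun v : Hilb d =>
      t * ‖v i‖ ^ 2 + (‖v‖ ^ 2 - ‖v i‖ ^ 2 - ‖v j‖ ^ 2)) v :=
    ((hc i).const_mul t).fun_add ((hn.fun_sub (hc i)).fun_sub (hc j))
  have hq : DifferentiableAt ℝ (fun v : Hilb d => (1 - t) * (‖v‖ ^ 2 - ‖v i‖ ^ 2) /
      (t * ‖v i‖ ^ 2 + (‖v‖ ^ 2 - ‖v i‖ ^ 2 - ‖v j‖ ^ 2))) v := by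
    simp only [div_eq_mul_inv]
    exact ((hn.fun_sub (hc i)).const_mul (1 - t)).fun_mul (hd.fun_inv hden.ne')
  have hs := (hq.sqrt (div_pos hnum hden).ne').sub_const 1
  have hs' := Complex.ofRealCLM.differentiableAt.comp v hs
  exact differentiableAt_id.add ((hs'.mul (hcoord i)).smul_const _)

theorem exists_rescale_eq {d : ℕ} {i j k : Fin d} (hij : i ≠ j) (hik : i ≠ k) (hjk : j ≠ k)
    {t : ℝ} (ht0 : 0 ≤ t) (ht1 : t < 1) {v : Hilb d} (hvk : v k ≠ 0)
    (hvi : ‖v i‖ ^ 2 < (1 - t) * ‖v‖ ^ 2) :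
    ∃ u : Hilb d, u k ≠ 0 ∧ rescale i j t u = v ∧
      ‖v i‖ ^ 2 * ‖setWeight j t u‖ ^ 2 = ‖setWeight j t u i‖ ^ 2 * ‖v‖ ^ 2 := by
  have h3 := sum_three_norm_sq_le hij hik hjk v
  have hk : 0 < ‖v k‖ ^ 2 := by positivity
  set s := ‖v‖ ^ 2 - ‖v i‖ ^ 2 - ‖v j‖ ^ 2 with hs
  have hs0 : 0 < s := by linarith
  set m := (1 - t) * ‖v‖ ^ 2 - ‖v i‖ ^ 2 with hm
  have hm0 : 0 < m := by linarith
  -- Equating the i-weight of `v` with that of `setWeight j t u`, where u i = κ v i, gives κ² m = s;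
  -- the bound on the i-weight of `v` makes `m` positive.
  set κ := Real.sqrt (s / m) with hκ
  have hκ0 : 0 < κ := Real.sqrt_pos.mpr (div_pos hs0 hm0)
  have hκ2 : κ ^ 2 = s / m := Real.sq_sqrt (div_pos hs0 hm0).le
  set u : Hilb d := v + (((κ - 1 : ℝ) : ℂ) * v i) • stdVec i with hu
  have hui : u i = (κ : ℂ) * v i := by
    rw [hu, add_smul_stdVec_self]; push_cast; ring
  have huj : u j = v j := add_smul_stdVec_of_ne hij.symm _ _
  have huk : u k = v k := add_smul_stdVec_of_ne hik.symm _ _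
  have hnui : ‖u i‖ ^ 2 = κ ^ 2 * ‖v i‖ ^ 2 := by
    rw [hui, norm_mul, Complex.norm_real, mul_pow, Real.norm_eq_abs, sq_abs]
  have hnu : ‖u‖ ^ 2 = ‖v‖ ^ 2 - ‖v i‖ ^ 2 + κ ^ 2 * ‖v i‖ ^ 2 := by
    rw [← hnui, hu, norm_sq_add_smul_stdVec, add_smul_stdVec_self]
  have hkey : κ ^ 2 * m = s := by rw [hκ2]; field_simp
  refine ⟨u, by rwa [huk], ?_, ?_⟩
  · have hsq : (1 - t) * (‖u‖ ^ 2 - ‖u i‖ ^ 2) /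
        (t * ‖u i‖ ^ 2 + (‖u‖ ^ 2 - ‖u i‖ ^ 2 - ‖u j‖ ^ 2)) = (κ⁻¹) ^ 2 := by
      have hd : t * ‖u i‖ ^ 2 + (‖u‖ ^ 2 - ‖u i‖ ^ 2 - ‖u j‖ ^ 2)
          = κ ^ 2 * ((1 - t) * (‖v‖ ^ 2 - ‖v i‖ ^ 2)) := by
        rw [hnu, hnui, huj]
        linear_combination (-1 : ℝ) * hkey + hs - κ ^ 2 * hm
      have hne : (1 - t) * (‖v‖ ^ 2 - ‖v i‖ ^ 2) ≠ 0 :=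
        (mul_pos (by linarith) (by have := sq_nonneg ‖v j‖; linarith)).ne'
      rw [hd, hnu, hnui, add_sub_cancel_right, inv_pow, mul_comm (κ ^ 2), ← div_div, div_self hne,
        one_div]
    rw [rescale, hsq, Real.sqrt_sq (inv_pos.mpr hκ0).le, hui, hu, add_assoc, ← add_smul]
    have : ((κ - 1 : ℝ) : ℂ) * v i + ((κ⁻¹ - 1 : ℝ) : ℂ) * ((κ : ℂ) * v i) = 0 := by
      have : (κ : ℂ) ≠ 0 := by exact_mod_cast hκ0.ne'
      push_cast
      field_simp
      ring
    rw [this, zero_smul, add_zero]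
  · rw [norm_sq_setWeight j ht0 ht1, setWeight_of_ne hij, hnu, huj, hnui]
    have : 1 - t ≠ 0 := by linarith
    field_simp
    linear_combination ‖v i‖ ^ 2 * (hs - hkey + κ ^ 2 * hm)

theorem null_setOf_coord_eq_zero {d : ℕ} (m : Measure (Hilb d)) [m.IsAddHaarMeasure] (k : Fin d) :
    m {v | v k = 0} = 0 := by
  let p : Hilb d →ₗ[ℝ] ℂ := ((EuclideanSpace.proj k : Hilb d →L[ℂ] ℂ).restrictScalars ℝ : _)
  have h := Measure.addHaar_submodule m (LinearMap.ker p) (fun htop => by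
    have : stdVec k ∈ LinearMap.ker p := htop ▸ Submodule.mem_top
    have : (stdVec k : Hilb d) k = 0 := this
    simp [stdVec] at this)
  exact measure_mono_null (fun v hv => hv) h

/-! ### Two stabilizers sweep out almost all vectors of small weight -/

/-- If, for a vector `l` with weight at most `c` on the `j`-th basis vector, almost every image of
`l` under the stabilizers of the `j`-th and `i`-th basis vectors avoids a cone, then so does almost
every vector with weight less than `1 - c` on the `i`-th basis vector. -/
theorem null_cone_of_ae_ae {d : ℕ} {m : Measure (Hilb d)} [m.IsAddHaarMeasure] {i j k : Fin d}
    (hij : i ≠ j) (hik : i ≠ k) (hjk : j ≠ k) {A : Set (Hilb d)} (hA : MeasurableSet A)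
    (hcone : ∀ (c : ℂ) (v : Hilb d), c ≠ 0 → (c • v ∈ A ↔ v ∈ A))
    {γi γj : Measure (UGroup d)} [SFinite γi] [SFinite γj] (hγi : γi ≠ 0) (hγj : γj ≠ 0)
    (hi : ∀ᵐ g ∂γi, g ∈ fixer (stdVec i)) (hj : ∀ᵐ g ∂γj, g ∈ fixer (stdVec j))
    (hinvi : ∀ g ∈ fixer (stdVec i), γi.map (· * g) = γi)
    (hinvj : ∀ g ∈ fixer (stdVec j), γj.map (· * g) = γj)
    {l : Hilb d} (hl : l ≠ 0) {c : ℝ} (hc : c < 1) (hlc : ‖l j‖ ^ 2 ≤ c * ‖l‖ ^ 2)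
    (h : ∀ᵐ (s : UGroup d) ∂γj, ∀ᵐ (g : UGroup d) ∂γi,
      (g : Hilb d →L[ℂ] Hilb d) ((s : Hilb d →L[ℂ] Hilb d) l) ∉ A) :
    m (A ∩ {v | v ≠ 0 ∧ ‖v i‖ ^ 2 < (1 - c) * ‖v‖ ^ 2}) = 0 := by
  have hl2 : 0 < ‖l‖ ^ 2 := by positivity
  set t := ‖l j‖ ^ 2 / ‖l‖ ^ 2 with ht
  have ht0 : 0 ≤ t := by positivity
  have htc : t ≤ c := (div_le_iff₀ hl2).mpr hlc
  have ht1 : t < 1 := htc.trans_lt hc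
  have hcone' : ∀ (c : ℂ) (v : Hilb d), c ≠ 0 → c • v ∈ A → v ∈ A := fun c v hc => (hcone c v hc).mp
  set D := hitSet γi A i (1 - t) with hD
  have hDm : MeasurableSet D := measurableSet_hitSet hA i _
  have hDcone : ∀ (c : ℂ) (v : Hilb d), c ≠ 0 → c • v ∈ D → v ∈ D := by
    intro c v hc hcv
    refine mem_hitSet_of_ratio_eq hinvi hcone' (fun h0 => hcv.1 (by rw [h0, smul_zero])) ?_ hcv
    rw [PiLp.smul_apply, norm_smul, norm_smul]; ring
  have hlD : ∀ᵐ (s : UGroup d) ∂γj, (s : Hilb d →L[ℂ] Hilb d) l ∉ D := by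
    filter_upwards [h] with s hs hsD
    exact hsD.2.2 (measure_eq_zero_iff_ae_notMem.mpr hs)
  -- `setWeight j t v` has the j-weight of `l`, so up to a scalar it lies in the orbit of `l` under
  -- the stabilizer of e_j. That stabilizer commutes with `setWeight`, so averaging over it applies
  -- to the preimage of `D`.
  have hWnull : m (setWeight j t ⁻¹' D ∩ {v | v k ≠ 0}) = 0 := by
    have hmeas : MeasurableSet {v : Hilb d | v k ≠ 0} :=
      (isOpen_ne_fun (f := fun v : Hilb d => v k) (by fun_prop) continuous_const).measurableSet
    refine measure_mono_null Set.inter_subset_left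
      (null_of_ae_ae_notMem hγj ((continuous_setWeight j t).measurable hDm) ?_)
    have hk : ∀ᵐ v ∂m, v k ≠ 0 := measure_eq_zero_iff_ae_notMem.mp (null_setOf_coord_eq_zero m k)
    filter_upwards [hk] with v hv
    have hWv : setWeight j t v ≠ 0 := fun h0 => hv (by
      rw [← setWeight_of_ne hjk.symm t v, h0]; rfl)
    have := ae_apply_notMem_of_ratio_eq hinvj hDcone hl hWv (by
      rw [norm_sq_setWeight j ht0 ht1, norm_sq_setWeight_self j ht0 ht1, ht]
      have : 1 - ‖l j‖ ^ 2 / ‖l‖ ^ 2 ≠ 0 := by rw [← ht]; linarith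
      field_simp) hlD
    filter_upwards [this, hj] with s hs hsj
    rwa [Set.mem_preimage, ← apply_setWeight hsj]
  -- Membership in `D` depends only on the i-weight, so off the hyperplane v k = 0 the set `D` lies
  -- in the image under `rescale` of the null set just found.
  have hDnull : m D = 0 := by
    have himg := addHaar_image_eq_zero_of_differentiableOn_of_addHaar_eq_zero m
      (f := rescale i j t) (fun v hv =>
        (differentiableAt_rescale hij hik hjk ht0 ht1 hv.2).differentiableWithinAt) hWnull
    refine measure_mono_null (fun v hv => ?_)
      (measure_union_null himg (null_setOf_coord_eq_zero m k))
    by_cases hvk : v k = 0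
    · exact Or.inr hvk
    · obtain ⟨u, huk, huv, hratio⟩ := exists_rescale_eq hij hik hjk ht0 ht1 hvk hv.2.1
      refine Or.inl ⟨u, ⟨?_, huk⟩, huv⟩
      refine mem_hitSet_of_ratio_eq hinvi hcone' (fun h0 => huk ?_) hratio hv
      rw [← setWeight_of_ne hjk.symm t u, h0]; rfl
  have hRm : MeasurableSet {v : Hilb d | v ≠ 0 ∧ ‖v i‖ ^ 2 < (1 - c) * ‖v‖ ^ 2} :=
    MeasurableSet.inter (measurableSet_singleton 0).compl
      (isOpen_lt (f := fun v : Hilb d => ‖v i‖ ^ 2) (by fun_prop) (by fun_prop)).measurableSet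
  refine null_of_ae_ae_notMem hγi (hA.inter hRm) ?_
  filter_upwards [measure_eq_zero_iff_ae_notMem.mp hDnull] with v hv
  by_cases hvR : v ≠ 0 ∧ ‖v i‖ ^ 2 < (1 - c) * ‖v‖ ^ 2
  · have h0 : γi {g : UGroup d | (g : Hilb d →L[ℂ] Hilb d) v ∈ A} = 0 := by
      by_contra hne
      refine hv ⟨hvR.1, hvR.2.trans_le ?_, hne⟩
      have := sq_nonneg ‖v‖
      nlinarith
    filter_upwards [measure_eq_zero_iff_ae_notMem.mp h0] with g hg hgA
    exact hg hgA.1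
  · filter_upwards [hi] with g hg hgA
    obtain ⟨h1, h2⟩ := hgA.2
    rw [fixer_apply_coord hg, g.norm_apply] at h2
    exact hvR ⟨fun h0 => h1 (by rw [h0, map_zero]), h2⟩

/-! ### Topology and measurability on projective space -/

/-- The saturation of an open set is a union of its scalar multiples. Openness matters because
products of open quotient maps are again quotient maps, which yields joint continuity of `actCP`. -/
theorem isOpenQuotientMap_mk' (d : ℕ) :
    IsOpenQuotientMap (Projectivization.mk' ℂ (V := Hilb d) : {v : Hilb d // v ≠ 0} → CP d) := by
  refine ⟨fun x => ⟨⟨x.rep, x.rep_nonzero⟩, x.mk_rep⟩, continuous_coinduced_rng, fun s hs => ?_⟩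
  have hcoind : IsOpen (Projectivization.mk' ℂ (V := Hilb d) ⁻¹'
      (Projectivization.mk' ℂ (V := Hilb d) '' s)) := by
    have : Projectivization.mk' ℂ (V := Hilb d) ⁻¹' (Projectivization.mk' ℂ (V := Hilb d) '' s)
        = ⋃ c : ℂˣ, (fun v : {v : Hilb d // v ≠ 0} =>
          (⟨c • (v : Hilb d), (smul_ne_zero_iff_ne c).mpr v.2⟩ : {v : Hilb d // v ≠ 0})) ⁻¹' s := by
      ext v
      simp only [Set.mem_preimage, Set.mem_image, Set.mem_iUnion]
      constructor
      · rintro ⟨w, hw, hwv⟩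
        obtain ⟨c, hc⟩ := (Projectivization.mk_eq_mk_iff ℂ _ _ w.2 v.2).mp hwv
        exact ⟨c, by convert hw⟩
      · rintro ⟨c, hc⟩
        exact ⟨_, hc, (Projectivization.mk_eq_mk_iff ℂ _ _ _ v.2).mpr ⟨c, rfl⟩⟩
    rw [this]
    refine isOpen_iUnion fun c => hs.preimage ?_
    exact Continuous.subtype_mk (continuous_subtype_val.const_smul c) _
  exact hcoind

theorem unitaryCP_mk {d : ℕ} (U : Hilb d ≃ₗᵢ[ℂ] Hilb d) {v : Hilb d} (hv : v ≠ 0) (hv' : U v ≠ 0) :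
    unitaryCP U (Projectivization.mk ℂ v hv) = Projectivization.mk ℂ (U v) hv' := rfl

/-- The action of the unitary group on projective space. -/
noncomputable def actCP {d : ℕ} (z : UGroup d × CP d) : CP d :=
  unitaryCP (Unitary.linearIsometryEquiv z.1) z.2

theorem continuous_actCP (d : ℕ) : Continuous (actCP : UGroup d × CP d → CP d) := by
  have hq := (IsOpenQuotientMap.id (X := UGroup d)).prodMap (isOpenQuotientMap_mk' d)
  rw [← hq.continuous_comp_iff]
  have hev : Continuous fun z : UGroup d × {v : Hilb d // v ≠ 0} =>
      (⟨(z.1 : Hilb d →L[ℂ] Hilb d) z.2, UGroup.apply_ne_zero z.1 z.2.2⟩ : {v : Hilb d // v ≠ 0}) :=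
    Continuous.subtype_mk ((continuous_subtype_val.comp continuous_fst).clm_apply
      (continuous_subtype_val.comp continuous_snd)) _
  exact (isOpenQuotientMap_mk' d).continuous.comp hev

/-- The set of nonzero vectors that represent a point of `N`. -/
def coneOver {d : ℕ} (N : Set (CP d)) : Set (Hilb d) :=
  {v | ∃ h : v ≠ 0, Projectivization.mk ℂ v h ∈ N}

theorem measurableSet_coneOver {d : ℕ} {N : Set (CP d)} (hN : MeasurableSet N) :
    MeasurableSet (coneOver N) := by
  have hm : Measurable (Projectivization.mk' ℂ (V := Hilb d)) :=
    (isOpenQuotientMap_mk' d).continuous.measurable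
  have h0 : MeasurableSet {v : Hilb d | v ≠ 0} := (measurableSet_singleton 0).compl
  have h := h0.subtype_image (hm hN)
  convert h using 1
  ext v
  constructor
  · rintro ⟨h, hv⟩; exact ⟨⟨v, h⟩, hv, rfl⟩
  · rintro ⟨w, hw, rfl⟩; exact ⟨w.2, hw⟩

theorem smul_mem_coneOver_iff {d : ℕ} (N : Set (CP d)) (c : ℂ) (v : Hilb d) (hc : c ≠ 0) :
    c • v ∈ coneOver N ↔ v ∈ coneOver N := by
  have key : ∀ (h : v ≠ 0) (h' : c • v ≠ 0),
      Projectivization.mk ℂ (c • v) h' = Projectivization.mk ℂ v h := fun h h' =>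
    (Projectivization.mk_eq_mk_iff' ℂ _ _ h' h).mpr ⟨c, rfl⟩
  constructor
  · rintro ⟨h, hN⟩
    have hv : v ≠ 0 := fun h0 => h (by rw [h0, smul_zero])
    exact ⟨hv, key hv h ▸ hN⟩
  · rintro ⟨h, hN⟩
    have hv : c • v ≠ 0 := smul_ne_zero hc h
    exact ⟨hv, (key h hv).symm ▸ hN⟩

/-- The points of projective space whose squared overlap with `ψ` is at most `c`. -/
def weightLE {d : ℕ} (ψ : Hilb d) (c : ℝ) : Set (CP d) :=
  {x | ‖inner ℂ ψ x.rep‖ ^ 2 ≤ c * ‖x.rep‖ ^ 2}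

theorem mk_mem_weightLE {d : ℕ} (ψ : Hilb d) (c : ℝ) {v : Hilb d} (hv : v ≠ 0) :
    Projectivization.mk ℂ v hv ∈ weightLE ψ c ↔ ‖inner ℂ ψ v‖ ^ 2 ≤ c * ‖v‖ ^ 2 := by
  obtain ⟨a, ha⟩ := Projectivization.exists_smul_eq_mk_rep ℂ v hv
  have ha0 : 0 < ‖(a : ℂ)‖ ^ 2 := by have := a.ne_zero; positivity
  change ‖inner ℂ ψ (Projectivization.mk ℂ v hv).rep‖ ^ 2
    ≤ c * ‖(Projectivization.mk ℂ v hv).rep‖ ^ 2 ↔ _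
  rw [← ha, Units.smul_def, inner_smul_right, norm_mul, norm_smul, mul_pow, mul_pow, mul_left_comm]
  exact mul_le_mul_iff_right₀ ha0

theorem measurableSet_weightLE {d : ℕ} (ψ : Hilb d) (c : ℝ) : MeasurableSet (weightLE ψ c) := by
  refine IsClosed.measurableSet ?_
  rw [← (isOpenQuotientMap_mk' d).isQuotientMap.isClosed_preimage]
  have : Projectivization.mk' ℂ (V := Hilb d) ⁻¹' weightLE ψ c
      = {v : {v : Hilb d // v ≠ 0} | ‖inner ℂ ψ (v : Hilb d)‖ ^ 2 ≤ c * ‖(v : Hilb d)‖ ^ 2} := by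
    ext v; exact mk_mem_weightLE ψ c v.2
  rw [this]
  exact isClosed_le (by fun_prop) (by fun_prop)

theorem unitaryCP_mem_weightLE {d : ℕ} (U : Hilb d ≃ₗᵢ[ℂ] Hilb d) (ψ : Hilb d) (c : ℝ) (x : CP d) :
    unitaryCP U x ∈ weightLE (U ψ) c ↔ x ∈ weightLE ψ c := by
  induction x using Projectivization.ind with
  | h v hv =>
    have hv' : U v ≠ 0 := by rwa [Ne, map_eq_zero_iff U U.injective]
    rw [unitaryCP_mk U hv hv', mk_mem_weightLE, mk_mem_weightLE, U.inner_map_map, U.norm_map]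

/-! ### Overlap of measures and total variation -/

/-- Bessel-type inequality for two almost orthogonal unit vectors. -/
theorem norm_inner_sq_add_norm_inner_sq_le {d : ℕ} {ψ φ : Hilb d} (hψ : ‖ψ‖ = 1) (hφ : ‖φ‖ = 1)
    (v : Hilb d) : ‖inner ℂ ψ v‖ ^ 2 + ‖inner ℂ φ v‖ ^ 2 ≤ (1 + ‖inner ℂ ψ φ‖) * ‖v‖ ^ 2 := by
  set a : ℂ := inner ℂ ψ v with ha
  set b : ℂ := inner ℂ φ v with hb
  set S := ‖a‖ ^ 2 + ‖b‖ ^ 2 with hS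
  have hS0 : 0 ≤ S := by positivity
  -- `w` is chosen so that ⟨w, v⟩ = S; Cauchy–Schwarz then bounds `S`.
  set w : Hilb d := a • ψ + b • φ with hw
  have hwv : inner ℂ w v = (S : ℂ) := by
    rw [hw, inner_add_left, inner_smul_left, inner_smul_left, ← ha, ← hb, hS,
      ← Complex.normSq_eq_conj_mul_self,
      ← Complex.normSq_eq_conj_mul_self, Complex.normSq_eq_norm_sq, Complex.normSq_eq_norm_sq]
    push_cast; ring
  have hcs : S ≤ ‖w‖ * ‖v‖ := by
    have := norm_inner_le_norm (𝕜 := ℂ) w v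
    rwa [hwv, Complex.norm_real, Real.norm_eq_abs, abs_of_nonneg hS0] at this
  have hww : ‖w‖ ^ 2 ≤ S * (1 + ‖inner ℂ ψ φ‖) := by
    rw [hw, @norm_add_sq ℂ, norm_smul, norm_smul, hψ, hφ, mul_one, mul_one, inner_smul_left,
      inner_smul_right]
    have h1 := Complex.re_le_norm ((starRingEnd ℂ) a * (b * inner ℂ ψ φ))
    rw [norm_mul, norm_mul, RCLike.norm_conj] at h1
    change ‖a‖ ^ 2 + 2 * ((starRingEnd ℂ) a * (b * inner ℂ ψ φ)).re + ‖b‖ ^ 2 ≤ _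
    nlinarith [mul_nonneg (norm_nonneg (inner ℂ ψ φ)) (sq_nonneg (‖a‖ - ‖b‖))]
  by_cases h0 : S = 0
  · rw [h0]; positivity
  · have hSpos : 0 < S := lt_of_le_of_ne hS0 (Ne.symm h0)
    have : S * S ≤ S * ((1 + ‖inner ℂ ψ φ‖) * ‖v‖ ^ 2) := by
      calc S * S ≤ (‖w‖ * ‖v‖) * (‖w‖ * ‖v‖) := mul_self_le_mul_self hS0 hcs
        _ = ‖w‖ ^ 2 * ‖v‖ ^ 2 := by ring
        _ ≤ (S * (1 + ‖inner ℂ ψ φ‖)) * ‖v‖ ^ 2 := by gcongr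
        _ = _ := by ring
    exact le_of_mul_le_mul_left this hSpos

/-- Mutually singular measures are themselves the Jordan decomposition of their difference, so its
total variation has mass 1 + 1. -/
theorem tvDist_eq_one_of_mutuallySingular {Λ : Type*} [MeasurableSpace Λ]
    {μ ν : ProbabilityMeasure Λ} (h : (μ : Measure Λ) ⟂ₘ (ν : Measure Λ)) : tvDist μ ν = 1 := by
  let J : JordanDecomposition Λ := ⟨(μ : Measure Λ), (ν : Measure Λ), h⟩
  have hJ : (μ : Measure Λ).toSignedMeasure - (ν : Measure Λ).toSignedMeasure
      = J.toSignedMeasure := rfl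
  have : ((μ : Measure Λ).toSignedMeasure - (ν : Measure Λ).toSignedMeasure).totalVariation
      Set.univ = 2 := by
    rw [hJ, SignedMeasure.totalVariation, J.toJordanDecomposition_toSignedMeasure,
      Measure.add_apply]
    change (μ : Measure Λ) Set.univ + (ν : Measure Λ) Set.univ = 2
    rw [measure_univ, measure_univ, one_add_one_eq_two]
  rw [tvDist, this]
  norm_num

/-- The standard basis vectors as quantum states. -/
noncomputable def stdState {d : ℕ} (i : Fin d) : QState d := ⟨stdVec i, by simp [stdVec]⟩

namespace OntologicalTheory

/-! ### Consequences for the response functions -/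

/-- Nontrivial overlap of almost orthogonal states forces each measure to charge ontic states that
have squared overlap at most `3/5` with the quantum state. -/
theorem measure_weightLE_ne_zero {d : ℕ} {T : OntologicalTheory d (CP d)}
    (hsym : T.IsStronglySymmetric) (hmax : T.IsMaximallyNontrivial) {i j k : Fin d}
    (hij : i ≠ j) (hik : i ≠ k) (hjk : j ≠ k) :
    (T.μ (stdState j) : Measure (CP d)) (weightLE (stdVec j) (3 / 5)) ≠ 0 := by
  intro h0
  -- From the Pythagorean triple (11, 60, 61), a unit vector with 1 + 11/61 < 2 · 3/5, so both
  -- weights cannot exceed 3/5.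
  set φv : Hilb d := ((11 / 61 : ℂ) • stdVec j) + (60 / 61 : ℂ) • stdVec k with hφv
  have hjφ : inner ℂ (stdVec j) φv = 11 / 61 := by
    rw [inner_stdVec]; simp [hφv, stdVec, hjk]
  have hiφ : inner ℂ (stdVec i) φv = 0 := by
    rw [inner_stdVec]; simp [hφv, stdVec, hij, hik]
  have hφn : ‖φv‖ = 1 := by
    have : ‖φv‖ ^ 2 = 1 := by
      rw [hφv, norm_sq_add_smul_stdVec]
      simp [stdVec, norm_smul, hjk.symm]
      norm_num
    exact (pow_eq_one_iff_of_nonneg (norm_nonneg _) two_ne_zero).mp this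
  obtain ⟨U, -, hU⟩ := exists_unitary_map_pair (e := stdVec i) (v := stdVec j) (w := φv)
    (by simp [stdVec]) (by simp [stdVec]) hφn (by rw [inner_stdVec]; simp [stdVec, hij]) hiφ
  have hφ : (unitaryState U (stdState j) : Hilb d) = φv := hU
  have hφ0 : (T.μ (unitaryState U (stdState j)) : Measure (CP d)) (weightLE φv (3 / 5)) = 0 := by
    rw [hsym, Measure.map_apply (measurable_unitaryCP U) (measurableSet_weightLE _ _)]
    refine measure_mono_null (fun x hx => ?_) h0
    rw [Set.mem_preimage, ← hU] at hx
    exact (unitaryCP_mem_weightLE U _ _ x).mp hx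
  have hlt := hmax (stdState j) (unitaryState U (stdState j)) (by
    rw [hφ]
    change inner ℂ (stdVec j) φv ≠ 0
    rw [hjφ]; norm_num)
  refine hlt.ne (tvDist_eq_one_of_mutuallySingular
    ⟨weightLE (stdVec j) (3 / 5), measurableSet_weightLE _ _, h0, ?_⟩)
  refine measure_mono_null (fun x hx => ?_) hφ0
  induction x using Projectivization.ind with
  | h v hv =>
    rw [Set.mem_compl_iff, mk_mem_weightLE, not_le] at hx
    rw [mk_mem_weightLE]
    have := norm_inner_sq_add_norm_inner_sq_le (ψ := stdVec j) (φ := φv) (by simp [stdVec]) hφn v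
    rw [hjφ] at this
    have hn : ‖(11 / 61 : ℂ)‖ = 11 / 61 := by norm_num
    rw [hn] at this
    nlinarith [sq_nonneg ‖v‖]

/-- Almost no ontic state of `ψ` responds to an outcome orthogonal to `ψ`. -/
theorem measure_setOf_response_ne_zero_eq_zero {d : ℕ} {Λ : Type*} [MeasurableSpace Λ]
    (T : OntologicalTheory d Λ) {M : OrthonormalBasis (Fin d) ℂ (Hilb d)} {k : Fin d} {ψ : QState d}
    (h : inner ℂ (M k) (ψ : Hilb d) = 0) :
    (T.μ ψ : Measure Λ) {x | T.ξ M k x ≠ 0} = 0 := by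
  have hb := T.born_rule M k ψ
  rw [h, norm_zero, zero_pow two_ne_zero] at hb
  have hint : Integrable (T.ξ M k) (T.μ ψ : Measure Λ) := by
    refine Integrable.of_bound (T.measurable_response M k).aestronglyMeasurable 1
      (Filter.Eventually.of_forall fun x => ?_)
    have := T.response_mem M k x
    rw [Real.norm_eq_abs, abs_of_nonneg this.1]
    exact this.2
  exact (integral_eq_zero_iff_of_nonneg (fun x => (T.response_mem M k x).1) hint).mp hb

/-- Almost no vector with weight less than `2/5` on the `i`-th basis vector responds to the `i`-th
outcome. -/
theorem null_coneOver_response {d : ℕ} {T : OntologicalTheory d (CP d)}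
    (hsym : T.IsStronglySymmetric) (hmax : T.IsMaximallyNontrivial) {i j k : Fin d}
    (hij : i ≠ j) (hik : i ≠ k) (hjk : j ≠ k) (m : Measure (Hilb d)) [m.IsAddHaarMeasure]
    {M : OrthonormalBasis (Fin d) ℂ (Hilb d)} (hM : M i = stdVec i) :
    m (coneOver {x | T.ξ M i x ≠ 0} ∩ {v | v ≠ 0 ∧ ‖v i‖ ^ 2 < (1 - 3 / 5) * ‖v‖ ^ 2}) = 0 := by
  set N : Set (CP d) := {x | T.ξ M i x ≠ 0}
  have hN : MeasurableSet N := (T.measurable_response M i (measurableSet_singleton 0)).compl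
  obtain ⟨γi, hfi, hγi, hi, hinvi⟩ :=
    exists_rightInvariant_measure (fixer (stdVec i : Hilb d)) (isClosed_fixer _)
  obtain ⟨γj, hfj, hγj, hj, hinvj⟩ :=
    exists_rightInvariant_measure (fixer (stdVec j : Hilb d)) (isClosed_fixer _)
  set μ : Measure (CP d) := (T.μ (stdState j) : Measure (CP d))
  -- Here g s e_j = g e_j, whose i-th coordinate is that of e_j, namely 0.
  have hfix : ∀ g ∈ fixer (stdVec i : Hilb d), ∀ s ∈ fixer (stdVec j : Hilb d),
      ∀ᵐ x ∂μ, actCP (g * s, x) ∉ N := by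
    intro g hg s hs
    let U := Unitary.linearIsometryEquiv (g * s)
    have hzero : (T.μ (unitaryState U (stdState j)) : Measure (CP d)) N = 0 := by
      refine T.measure_setOf_response_ne_zero_eq_zero ?_
      rw [hM, inner_stdVec]
      change (g : Hilb d →L[ℂ] Hilb d) ((s : Hilb d →L[ℂ] Hilb d) (stdVec j)) i = 0
      rw [fixer_apply_coord hg, mem_fixer.mp hs]
      simp [stdVec, hij]
    rw [hsym, Measure.map_apply (measurable_unitaryCP U) hN] at hzero
    exact measure_eq_zero_iff_ae_notMem.mp hzero
  have hpair : ∀ᵐ z ∂(γj.prod γi), ∀ᵐ x ∂μ, actCP (z.2 * z.1, x) ∉ N := by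
    have h1 : ∀ᵐ z ∂(γj.prod γi), z.1 ∈ fixer (stdVec j : Hilb d) :=
      Measure.quasiMeasurePreserving_fst.ae hj
    have h2 : ∀ᵐ z ∂(γj.prod γi), z.2 ∈ fixer (stdVec i : Hilb d) :=
      Measure.quasiMeasurePreserving_snd.ae hi
    filter_upwards [h1, h2] with z hz1 hz2
    exact hfix _ hz2 _ hz1
  have hmeas : Measurable fun y : (UGroup d × UGroup d) × CP d => actCP (y.1.2 * y.1.1, y.2) := by
    refine (continuous_actCP d).measurable.comp (Measurable.prodMk ?_ measurable_snd)
    exact (continuous_snd.mul continuous_fst).measurable.comp measurable_fst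
  -- Exchanging quantifiers lets a single ray serve almost all pairs; positive mass lets it be
  -- chosen with j-weight at most 3/5.
  have hcomm := (Measure.ae_ae_comm (μ := γj.prod γi) (ν := μ)
    (p := fun z x => actCP (z.2 * z.1, x) ∉ N) (hmeas hN.compl)).mp hpair
  have hfreq : ∃ᵐ x ∂μ, x ∈ weightLE (stdVec j) (3 / 5) :=
    frequently_ae_mem_iff.mpr (measure_weightLE_ne_zero hsym hmax hij hik hjk)
  obtain ⟨x, hx, hxN⟩ := (hfreq.and_eventually hcomm).exists
  induction x using Projectivization.ind with
  | h l hl =>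
    rw [mk_mem_weightLE, inner_stdVec] at hx
    refine null_cone_of_ae_ae hij hik hjk (measurableSet_coneOver hN)
      (fun c v hc => smul_mem_coneOver_iff N c v hc) hγi hγj hi hj hinvi hinvj hl (by norm_num) hx ?_
    filter_upwards [Measure.ae_ae_of_ae_prod hxN] with s hs
    filter_upwards [hs] with g hg hgN
    exact hg hgN.2

end OntologicalTheory

/-! ### Contradiction with normalization of the responses -/

theorem exists_distinct_indices {d : ℕ} (hd : 3 ≤ d) (i : Fin d) :
    ∃ j k : Fin d, i ≠ j ∧ i ≠ k ∧ j ≠ k := by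
  have h := Finset.card_erase_of_mem (Finset.mem_univ i)
  rw [Finset.card_univ, Fintype.card_fin] at h
  obtain ⟨j, hj, k, hk, hjk⟩ := Finset.one_lt_card.mp
    (show 1 < (Finset.univ.erase i).card by omega)
  exact ⟨j, k, (Finset.ne_of_mem_erase hj).symm, (Finset.ne_of_mem_erase hk).symm, hjk⟩

/-- A strongly symmetric theory in dimension at least three is not maximally nontrivial. -/
theorem OntologicalTheory.not_isMaximallyNontrivial_of_isStronglySymmetric {d : ℕ} (hd : 3 ≤ d)
    {T : OntologicalTheory d (CP d)} (hsym : T.IsStronglySymmetric) :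
    ¬ T.IsMaximallyNontrivial := by
  intro hmax
  let m : Measure (Hilb d) := Measure.addHaar
  let M := EuclideanSpace.basisFun (Fin d) ℂ
  have hnull : m (⋃ i, coneOver {x | T.ξ M i x ≠ 0} ∩
      {v | v ≠ 0 ∧ ‖v i‖ ^ 2 < (1 - 3 / 5) * ‖v‖ ^ 2}) = 0 := by
    refine measure_iUnion_null fun i => ?_
    obtain ⟨j, k, hij, hik, hjk⟩ := exists_distinct_indices hd i
    exact OntologicalTheory.null_coneOver_response hsym hmax hij hik hjk m
      (EuclideanSpace.basisFun_apply _ _ i)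
  let R : Set (Hilb d) := ⋂ i, {v | ‖v i‖ ^ 2 < (1 - 3 / 5) * ‖v‖ ^ 2}
  have hRo : IsOpen R := isOpen_iInter_of_finite fun i =>
    isOpen_lt (f := fun v : Hilb d => ‖v i‖ ^ 2) (by fun_prop) (by fun_prop)
  have hRne : R.Nonempty := by
    -- The all-ones vector has every weight equal to 1/d ≤ 1/3 < 2/5.
    refine ⟨WithLp.toLp 2 fun _ => 1, Set.mem_iInter.mpr fun i => ?_⟩
    have hd' : (3 : ℝ) ≤ d := by exact_mod_cast hd
    change ‖(1 : ℂ)‖ ^ 2 < (1 - 3 / 5) * ‖(WithLp.toLp 2 fun _ => 1 : Hilb d)‖ ^ 2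
    rw [EuclideanSpace.norm_sq_eq]
    simp
    linarith
  refine (hRo.measure_pos m hRne).ne' (measure_mono_null (fun v hv => ?_) hnull)
  have hv' := Set.mem_iInter.mp hv
  have hv0 : v ≠ 0 := by
    rintro rfl
    have := hv' ⟨0, by omega⟩
    simp at this
  have hsum := T.sum_response M (Projectivization.mk ℂ v hv0)
  obtain ⟨i, -, hi⟩ := Finset.exists_ne_zero_of_sum_ne_zero (hsum.trans_ne one_ne_zero)
  exact Set.mem_iUnion.mpr ⟨i, ⟨hv0, hi⟩, hv0, hv' i⟩

end PsiEpistemic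

theorem mainTheorem2 (d : ℕ) (hd : 3 ≤ d) :
    ¬ ∃ T : PsiEpistemic.OntologicalTheory d (PsiEpistemic.CP d),
      T.IsPsiEpistemic ∧ T.IsStronglySymmetric ∧ T.IsMaximallyNontrivial := by
  rintro ⟨T, -, hsym, hmax⟩
  exact PsiEpistemic.OntologicalTheory.not_isMaximallyNontrivial_of_isStronglySymmetric hd hsym hmax
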